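/- **Problem.** Consider $\min_{\mathbf x\in\mathcal X} c_0(\mathbf x)+\mathrm E_{\xi}[\min_{\mathbf y\in\mathcal Y(\mathbf x)}q(\mathbf x,\mathbf y,\xi)]$, where $\xi\sim F$ has values in $\Xi\subset\mathbb R^m$, $\mathcal X\subset\mathbb R^{d_1}$ and $\mathcal Y(\mathbf x)\subset\mathbb R^{d_2}$ are finite and non-empty, and $q(\mathbf x,\mathbf y,\cdot)$ is continuous on $\Xi$. **Metamodels.** For a correlation function $r_\phi(z-z')$ with parameter $\phi$ (with $r_\phi(0)=1$, correlation matrices of distinct points positive definite, and $r_\phi(h)$ continuous in $\phi$ for each $h$), a variance $v>0$, a finite design set $S$ with outputs $\bar G_S$ and diagonal noise covariance $V$, write $\Sigma=(v\,r_\phi(z_i-z_j))_{i,j}$ and $\Sigma_z=(v\,r_\phi(z-z_i))_i$. The kriging predictor has mean $\widehat G(z)=\widehat\mu+\Sigma_z'(\Sigma+V)^{-1}(\bar G_S-\widehat\mu\mathbf 1)$, with $\widehat\mu=[\mathbf 1'(\Sigma+V)^{-1}\mathbf 1]^{-1}\mathbf 1'(\Sigma+V)^{-1}\bar G_S$, and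 covariance $v\,r_\phi(z-z')-\Sigma_z'(\Sigma+V)^{-1}\Sigma_{z'}+\eta_z\eta_{z'}[\mathbf 1'(\Sigma+V)^{-1}\mathbf 1]^{-1}$, with $\eta_z=1-\mathbf 1'(\Sigma+V)^{-1}\Sigma_z$; its diagonal is $s^2(z)$. In all uses $(v,\phi)$ is a maximum likelihood estimate, over a set of admissible pairs with $v>0$, under the model $\bar G_S\sim N(\mu\mathbf 1,\Sigma+V)$. The *local* metamodel at $\mathbf x$ has domain $\{(\mathbf y,\xi)\}$, outputs $q(\mathbf x,\cdot,\cdot)$ and $V=0$; the *global* metamodel has domain $\mathcal X$. **Procedure.** Fix integers $s,n_0,B\ge1$, $T\ge2$, and reals $g>1$, $\alpha_0,\overline M,\sigma_{\min}>0$. Start with a non-empty $D^{(1)}\subset\mathcal X$ and put $\mathcal S^{(k)}=\bigcup_{l\le k}D^{(l)}$. Iteration $k=1,2,\dots$ (there is no budget limit) consists of the following steps. 1. *Second stage.* For each $\mathbf x\in D^{(k)}$, say at its $t$-th visit, set $N^{(k)}(\mathbf x)=\lceil n_0g^{t-1}\rceil$ and $\alpha=\alpha_0g^{-(t-1)/2}$.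 Keep the old scenarios of $\mathbf x$ and add new i.i.d. scenarios from $F$ up to this number. (For $\mathbf x\notin D^{(k)}$ everything stored at $\mathbf x$ is unchanged; $N^{(k)}(\mathbf x)=0$ before the first visit.) At the first visit, build the local metamodel on a non-empty finite initial design in $\mathcal Y(\mathbf x)\times\Xi$. For every new scenario $\xi_j$ let $\widehat{\mathbf y}_j$ minimize the local posterior mean over $\mathcal Y(\mathbf x)$. Let $\mathrm{EI}_j(\mathbf y)=\mathrm E[\max(q(\mathbf x,\widehat{\mathbf y}_j,\xi_j)-\widetilde q,0)]$, where $\widetilde q$ has the local posterior normal law at $(\mathbf y,\xi_j)$. Scenarios with $\max_{\mathbf y}\mathrm{EI}_j(\mathbf y)\le\alpha|q(\mathbf x,\widehat{\mathbf y}_j,\xi_j)|$ are finished. Sweep repeatedly through the unfinished scenarios: take $\mathbf y^{EI}$ maximizing $\mathrm{EI}_j$; if $\mathrm{EI}_j(\mathbf y^{EI})\le\alpha|q(\mathbf x,\widehat{\mathbf y}_j,\xi_j)|$, the scenario is finished; otherwise add $(\mathbf y^{EI},\xi_j)$ to the local design, update the local metamodel, and replace $\widehat{\mathbf y}_j$ by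 $\mathbf y^{EI}$ if that has the smaller response. Stop when all scenarios are finished. 2. *Estimates.* For each $\mathbf x\in D^{(k)}$ draw $B$ sample paths $\widetilde q^{(b)}$ of the local posterior on $\mathcal Y(\mathbf x)\times\{\xi_j\}$, let $\widehat\delta_j=\frac1B\sum_b\max\bigl(0,q(\mathbf x,\widehat{\mathbf y}_j,\xi_j)-\min_{\mathbf y}\widetilde q^{(b)}(\mathbf y,\xi_j)\bigr)$, and let $\bar G(\mathbf x)$ be the average over $j\le N^{(k)}(\mathbf x)$ of $c_0(\mathbf x)+q(\mathbf x,\widehat{\mathbf y}_j,\xi_j)-\widehat\delta_j$, truncated to $[-\overline M,\overline M]$. Let $V(\mathbf x)$ be the sample variance of the means of $T$ bootstrap resamples of these $N^{(k)}(\mathbf x)$ numbers. 3. *First stage.* Fit the global metamodel $\widehat G,s^2$ to $(\bar G,V)$ on $\mathcal S^{(k)}$; at points of $\mathcal S^{(k)}$ replace $s^2$ by $\max(s^2,\sigma_{\min}^2)$. Let $\widehat{\mathbf x}^{\star}\in\arg\min_{\mathcal S^{(k)}}\bar G$ and $$f^{(k+1)}(\mathbf x)=\frac{\Pr\{\widetilde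 G(\mathbf x)<\bar G(\widehat{\mathbf x}^{\star})\}}{\sum_{\mathbf x'\in\mathcal X}\Pr\{\widetilde G(\mathbf x')<\bar G(\widehat{\mathbf x}^{\star})\}},\qquad \widetilde G(\mathbf x)\sim N(\widehat G(\mathbf x),s^2(\mathbf x)).$$ Given the past, draw $s$ points independently from $f^{(k+1)}$; they form $D^{(k+1)}$. **Statement.** Assume: (1) $c_0+q$ is bounded on all $(\mathbf x,\mathbf y,\xi)$ with $\mathbf x\in\mathcal X$, $\mathbf y\in\mathcal Y(\mathbf x)$, $\xi\in\Xi$, and the norms of $q(\mathbf x,\cdot,\cdot)$, $\mathbf x\in\mathcal X$, in the reproducing kernel Hilbert spaces on $\mathcal Y(\mathbf x)\times\Xi$ of the local correlation functions (at their true parameters) are bounded by a constant; (2) $\mathcal X$ and all $\mathcal Y(\mathbf x)$ are finite; (3) the true spatial variances $\tau^2$ (global) and $\sigma^2$ (local) are strictly positive; (4) the maximum likelihood estimates are strongly consistent: with probability 1 the estimates of $\tau^2$ and of the global correlation parameter converge to their true values as $k\to\infty$, and for each $\mathbf x$, with probability 1, if $N^{(k)}(\mathbf x)\to\infty$ then the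 estimates of $\sigma^2$ and of the local correlation parameter at $\mathbf x$ converge to their true values. Then for every $\mathbf x\in\mathcal X$, $N^{(k)}(\mathbf x)\to\infty$ with probability 1 as $k\to\infty$. -/

import Mathlib

open MeasureTheory ProbabilityTheory Filter Topology Matrix

noncomputable section

/-- Points of `ℝⁿ`. -/
abbrev Vec (n : ℕ) : Type := EuclideanSpace ℝ (Fin n)

/-! ### The two-stage problem -/

/-- The two-stage stochastic program
`min_{x ∈ X} c₀(x) + E_ξ[ min_{y ∈ Y(x)} q(x, y, ξ) ]`, `ξ ∼ F`,
with finite feasible sets and relatively complete recourse. -/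
structure TwoStageProblem (d₁ d₂ m : ℕ) where
  /-- first-stage feasible set -/
  X : Finset (Vec d₁)
  X_nonempty : X.Nonempty
  /-- second-stage feasible sets -/
  Y : Vec d₁ → Finset (Vec d₂)
  Y_nonempty : ∀ x ∈ X, (Y x).Nonempty
  /-- scenario set -/
  Ξ : Set (Vec m)
  measurableSet_Ξ : MeasurableSet Ξ
  /-- law of the scenario -/
  F : Measure (Vec m)
  isProbabilityMeasure_F : IsProbabilityMeasure F
  F_compl : F Ξᶜ = 0
  /-- first-stage cost -/
  c₀ : Vec d₁ → ℝ
  /-- second-stage response -/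
  q : Vec d₁ → Vec d₂ → Vec m → ℝ
  q_continuousOn : ∀ x ∈ X, ∀ y ∈ Y x, ContinuousOn (q x y) Ξ

/-- The first-stage feasible decisions, as a (finite) type. -/
abbrev TwoStageProblem.Dec {d₁ d₂ m : ℕ} (P : TwoStageProblem d₁ d₂ m) : Type :=
  {x : Vec d₁ // x ∈ P.X}

/-! ### Gaussian process metamodels -/

/-- A parametric family of stationary correlation functions `r(z - z' ; φ)`, together with the set
`Θ` of admissible pairs (spatial variance, correlation parameters) of the Gaussian process. -/
structure CorrelationFamily (E : Type*) [AddCommGroup E] (p : ℕ) where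
  Θ : Set (ℝ × Vec p)
  var_pos : ∀ θ ∈ Θ, 0 < θ.1
  corr : Vec p → E → ℝ
  corr_zero : ∀ θ ∈ Θ, corr θ.2 0 = 1
  /-- correlation matrices of distinct points are symmetric positive definite -/
  posDef : ∀ θ ∈ Θ, ∀ S : Finset E, (Matrix.of fun i j : S => corr θ.2 (i.1 - j.1)).PosDef
  continuousOn : ∀ h : E, ContinuousOn (fun φ => corr φ h) (Prod.snd '' Θ)

/-- `(r(z, z'))` as a two-point function. -/
def CorrelationFamily.ker {E : Type*} [AddCommGroup E] {p : ℕ} (C : CorrelationFamily E p)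
    (φ : Vec p) (z z' : E) : ℝ := C.corr φ (z - z')

namespace Kriging

/-! Stochastic kriging with unknown constant trend: design set `S`, outputs `G` observed with
independent noise of variances `V`, spatial variance `v`, correlation function `r`.
With `V = 0` this is ordinary kriging of a deterministic response. -/

variable {E : Type*}

open Classical in
/-- `Σ + V`. -/
def covMatrix (v : ℝ) (r : E → E → ℝ) (S : Finset E) (V : E → ℝ) : Matrix S S ℝ :=
  v • (Matrix.of fun i j : S => r i.1 j.1) + Matrix.diagonal fun i : S => V i.1

open Classical in
/-- `(Σ + V)⁻¹`. -/
def precision (v : ℝ) (r : E → E → ℝ) (S : Finset E) (V : E → ℝ) : Matrix S S ℝ :=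
  (covMatrix v r S V)⁻¹

/-- `Σ(z, ·)`. -/
def covVec (v : ℝ) (r : E → E → ℝ) (S : Finset E) (z : E) : S → ℝ := fun i => v * r z i.1

/-- `1ᵀ (Σ + V)⁻¹ 1`. -/
def ones (v : ℝ) (r : E → E → ℝ) (S : Finset E) (V : E → ℝ) : ℝ :=
  (fun _ : S => (1 : ℝ)) ⬝ᵥ (precision v r S V *ᵥ fun _ => 1)

/-- Generalized least squares estimate of the trend. -/
def trend (v : ℝ) (r : E → E → ℝ) (S : Finset E) (V G : E → ℝ) : ℝ :=
  (ones v r S V)⁻¹ * ((fun _ : S => (1 : ℝ)) ⬝ᵥ (precision v r S V *ᵥ fun i => G i.1))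

/-- Posterior mean at `z`. -/
def postMean (v : ℝ) (r : E → E → ℝ) (S : Finset E) (V G : E → ℝ) (z : E) : ℝ :=
  trend v r S V G +
    covVec v r S z ⬝ᵥ (precision v r S V *ᵥ fun i => G i.1 - trend v r S V G)

/-- `η(z) = 1 - 1ᵀ (Σ + V)⁻¹ Σ(z, ·)`. -/
def eta (v : ℝ) (r : E → E → ℝ) (S : Finset E) (V : E → ℝ) (z : E) : ℝ :=
  1 - (fun _ : S => (1 : ℝ)) ⬝ᵥ (precision v r S V *ᵥ covVec v r S z)

/-- Posterior covariance between `z` and `z'`; on the diagonal, the posterior variance `s²(z)`. -/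
def postCov (v : ℝ) (r : E → E → ℝ) (S : Finset E) (V : E → ℝ) (z z' : E) : ℝ :=
  v * r z z' - covVec v r S z ⬝ᵥ (precision v r S V *ᵥ covVec v r S z')
    + eta v r S V z * (ones v r S V)⁻¹ * eta v r S V z'

open Classical in
/-- Gaussian log-likelihood of the outputs `G` on `S` under `N(β 1, Σ + V)`. -/
def logLik (β v : ℝ) (r : E → E → ℝ) (S : Finset E) (V G : E → ℝ) : ℝ :=
  -((S.card : ℝ) / 2) * Real.log (2 * Real.pi) - Real.log (covMatrix v r S V).det / 2
    - ((fun i : S => G i.1 - β) ⬝ᵥ (precision v r S V *ᵥ fun i => G i.1 - β)) / 2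

/-- `θ = (v, φ)` is a maximum likelihood estimate (jointly with some trend) over `Θ`. -/
def IsMLE {p : ℕ} (Θ : Set (ℝ × Vec p)) (r : Vec p → E → E → ℝ) (S : Finset E) (V G : E → ℝ)
    (θ : ℝ × Vec p) : Prop :=
  θ ∈ Θ ∧ ∃ β : ℝ, ∀ θ' ∈ Θ, ∀ β' : ℝ,
    logLik β' θ'.1 (r θ'.2) S V G ≤ logLik β θ.1 (r θ.2) S V G

end Kriging

/-! ### Tuning constants -/

/-- Constants of the procedure. `Mbar` is the truncation level of the objective estimates and
`σmin` the lower bound for the predictive standard deviation at visited points. -/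
structure AlgParams where
  /-- number of first-stage points drawn per iteration -/
  s : ℕ
  s_pos : 0 < s
  /-- number of scenarios at the first visit -/
  n₀ : ℕ
  n₀_pos : 0 < n₀
  /-- number of posterior sample paths used to estimate optimality gaps -/
  B : ℕ
  B_pos : 0 < B
  /-- number of bootstrap samples -/
  T : ℕ
  two_le_T : 2 ≤ T
  /-- growth factor -/
  g : ℝ
  one_lt_g : 1 < g
  /-- initial relative expected improvement threshold -/
  α₀ : ℝ
  α₀_pos : 0 < α₀
  Mbar : ℝ
  Mbar_pos : 0 < Mbar
  σmin : ℝ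
  σmin_pos : 0 < σmin

/-- Accumulated number of scenarios after `t` visits. -/
def AlgParams.numScen (A : AlgParams) (t : ℕ) : ℕ :=
  if t = 0 then 0 else ⌈(A.n₀ : ℝ) * A.g ^ (t - 1)⌉₊

/-- Relative expected improvement threshold at the `t`-th visit. -/
def AlgParams.threshold (A : AlgParams) (t : ℕ) : ℝ :=
  A.α₀ * A.g ^ (-(((t : ℝ) - 1) / 2))

/-! ### Second-stage search at one first-stage decision -/

/-- What is stored at a first-stage decision: the design set of the local metamodel, its current
estimated parameters (spatial variance, correlation parameters), the current best second-stage
decision of every scenario, and the set of finished scenarios. -/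
structure LocalState (d₂ m p : ℕ) where
  design : Finset (Vec d₂ × Vec m)
  param : ℝ × Vec p
  best : ℕ → Vec d₂
  done : Finset ℕ

section SecondStage

variable {d₁ d₂ m p : ℕ} (P : TwoStageProblem d₁ d₂ m) (C : CorrelationFamily (Vec d₂ × Vec m) p)

/-- The estimated parameters are maximum likelihood estimates for the current design set. -/
def LocalFit (x : Vec d₁) (a : LocalState d₂ m p) : Prop :=
  Kriging.IsMLE C.Θ C.ker a.design (fun _ => 0) (fun z => P.q x z.1 z.2) a.param

/-- Local posterior mean. -/
def localMean (x : Vec d₁) (a : LocalState d₂ m p) (z : Vec d₂ × Vec m) : ℝ :=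
  Kriging.postMean a.param.1 (C.ker a.param.2) a.design (fun _ => 0) (fun z => P.q x z.1 z.2) z

/-- Local posterior covariance. -/
def localCov (a : LocalState d₂ m p) (z z' : Vec d₂ × Vec m) : ℝ :=
  Kriging.postCov a.param.1 (C.ker a.param.2) a.design (fun _ => 0) z z'

/-- Expected improvement of `y` over the current best decision for scenario `j`; `ξ` is the list of
scenarios. -/
def expImprovement (x : Vec d₁) (ξ : ℕ → Vec m) (a : LocalState d₂ m p) (j : ℕ) (y : Vec d₂) : ℝ :=
  ∫ v, max (P.q x (a.best j) (ξ j) - v) 0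
    ∂(gaussianReal (localMean P C x a (y, ξ j)) (localCov C a (y, ξ j) (y, ξ j)).toNNReal)

/-- The relative expected improvement of `y` does not exceed `α`
(written without division by the response). -/
def SmallEI (x : Vec d₁) (α : ℝ) (ξ : ℕ → Vec m) (a : LocalState d₂ m p) (j : ℕ) (y : Vec d₂) :
    Prop :=
  expImprovement P C x ξ a j y ≤ α * |P.q x (a.best j) (ξ j)|

open Classical in
/-- One pass through the body of the search loop for scenario `j`, from state `a` to `b`. -/
def ScenarioStep (x : Vec d₁) (α : ℝ) (ξ : ℕ → Vec m) (j : ℕ) (a b : LocalState d₂ m p) : Prop :=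
  (j ∈ a.done ∧ b = a) ∨
  (j ∉ a.done ∧ ∃ y ∈ P.Y x,
    (∀ y' ∈ P.Y x, expImprovement P C x ξ a j y' ≤ expImprovement P C x ξ a j y) ∧
    ((SmallEI P C x α ξ a j y ∧ b = { a with done := insert j a.done }) ∨
     (¬ SmallEI P C x α ξ a j y ∧
        b.done = a.done ∧
        b.design = insert (y, ξ j) a.design ∧
        LocalFit P C x b ∧
        b.best = Function.update a.best j
          (if P.q x y (ξ j) < P.q x (a.best j) (ξ j) then y else a.best j))))

/-- The `for` loop over a list of scenarios. -/
def Sweep (x : Vec d₁) (α : ℝ) (ξ : ℕ → Vec m) :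
    List ℕ → LocalState d₂ m p → LocalState d₂ m p → Prop
  | [], a, b => b = a
  | j :: l, a, b => ∃ c, ScenarioStep P C x α ξ j a c ∧ Sweep x α ξ l c b

/-- The `while` loop: sweep over the scenarios `0, …, N - 1` until all of them are finished. -/
inductive SearchLoop (x : Vec d₁) (α : ℝ) (ξ : ℕ → Vec m) (N : ℕ) :
    LocalState d₂ m p → LocalState d₂ m p → Prop
  | finish (a : LocalState d₂ m p) (h : a.done.card = N) : SearchLoop x α ξ N a a
  | sweep (a b c : LocalState d₂ m p) (h : a.done.card < N)
      (hab : Sweep P C x α ξ (List.range N) a b) (hbc : SearchLoop x α ξ N b c) :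
      SearchLoop x α ξ N a c

/-- The second-stage search at a visit of `x`: `N'` and `N` are the accumulated numbers of scenarios
before and after the visit (`N' = 0` at the first visit), `ξ` lists the scenarios, `lhd` is the
space-filling initial design used at the first visit, `a` and `b` are the stored states before and
after the visit. The state `i` is the one at the start of the loop. -/
def SecondStage (x : Vec d₁) (α : ℝ) (ξ : ℕ → Vec m) (N' N : ℕ) (lhd : Finset (Vec d₂ × Vec m))
    (a b : LocalState d₂ m p) : Prop :=
  ∃ i : LocalState d₂ m p,
    -- local metamodel
    (N' = 0 → i.design = lhd ∧ LocalFit P C x i) ∧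
    (N' ≠ 0 → i.design = a.design ∧ i.param = a.param) ∧
    -- old scenarios keep their current best decision, new ones minimize the posterior mean
    (∀ j < N', i.best j = a.best j) ∧
    (∀ j, N' ≤ j → j < N → i.best j ∈ P.Y x ∧
      ∀ y ∈ P.Y x, localMean P C x i (i.best j, ξ j) ≤ localMean P C x i (y, ξ j)) ∧
    -- scenarios that already meet the stopping criterion
    (∀ j, j ∈ i.done ↔ j < N ∧ ∀ y ∈ P.Y x, SmallEI P C x α ξ i j y) ∧
    SearchLoop P C x α ξ N i b

end SecondStage

/-! ### Runs of the procedure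

Time is indexed so that `D k` is the design set visited in iteration `k + 1`, while `loc k`, `θ k`,
`xstar k` and all derived quantities with index `k` describe the situation after `k` iterations. -/

/-- The random elements produced in a run. -/
structure Run {d₁ d₂ m : ℕ} (P : TwoStageProblem d₁ d₂ m) (A : AlgParams) (p₁ p₂ : ℕ)
    (Ω : Type*) where
  /-- first-stage points visited in iteration `k + 1` -/
  D : ℕ → Ω → Finset P.Dec
  /-- the `s` points drawn from the sampling distribution -/
  draw : ℕ → Ω → Fin A.s → P.Dec
  /-- initial second-stage design sets -/
  lhd : P.Dec → Ω → Finset (Vec d₂ × Vec m)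
  /-- scenarios offered in iteration `k + 1` -/
  scen : ℕ → Ω → P.Dec × ℕ → Vec m
  /-- standard normal variables generating the posterior sample paths in iteration `k + 1` -/
  mc : ℕ → Ω → (Σ x : P.Dec, Fin A.B × {y // y ∈ P.Y x.1} × ℕ) → ℝ
  /-- uniform variables generating the bootstrap resamples in iteration `k + 1` -/
  boot : ℕ → Ω → P.Dec × Fin A.T × ℕ → ℝ
  /-- second-stage states -/
  loc : ℕ → Ω → P.Dec → LocalState d₂ m p₂
  /-- estimated parameters of the global metamodel -/
  θ : ℕ → Ω → ℝ × Vec p₁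
  /-- current best first-stage decision -/
  xstar : ℕ → Ω → P.Dec

namespace Run

variable {d₁ d₂ m p₁ p₂ : ℕ} {P : TwoStageProblem d₁ d₂ m} {A : AlgParams} {Ω : Type*}
  (R : Run P A p₁ p₂ Ω) (CG : CorrelationFamily (Vec d₁) p₁)
  (CL : CorrelationFamily (Vec d₂ × Vec m) p₂)

open Classical in
/-- All first-stage points visited in the first `k` iterations. -/
def visited (k : ℕ) (ω : Ω) : Finset P.Dec := (Finset.range k).biUnion fun l => R.D l ω

open Classical in
/-- Number of visits of `x` in the first `k` iterations. -/
def visits (k : ℕ) (ω : Ω) (x : P.Dec) : ℕ := ((Finset.range k).filter fun l => x ∈ R.D l ω).card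

/-- `N^{(k)}(x)`: number of scenarios allocated to `x` in the first `k` iterations. -/
def N (k : ℕ) (ω : Ω) (x : P.Dec) : ℕ := A.numScen (R.visits k ω x)

open Classical in
/-- The scenarios at `x` after `k` iterations (only those with index below `N k ω x` count):
a visit keeps the old scenarios and appends new ones. -/
def scenario : ℕ → Ω → P.Dec → ℕ → Vec m
  | 0 => fun _ _ _ => 0
  | k + 1 => fun ω x j =>
      if x ∈ R.D k ω ∧ R.N k ω x ≤ j then R.scen k ω (x, j) else scenario k ω x j

/-- The pair (second-stage decision, scenario). -/
def gridPoint (k : ℕ) (ω : Ω) (x : P.Dec) (n : ℕ) (u : {y // y ∈ P.Y x.1} × Fin n) :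
    Vec d₂ × Vec m := (u.1.1, R.scenario k ω x u.2)

open Classical in
open scoped MatrixOrder in
/-- The `b`-th posterior sample path of the local metamodel at the end of the second-stage search in
iteration `k + 1`, on the grid of all second-stage decisions and all scenarios at `x`:
a Gaussian vector with the posterior mean and the posterior covariance matrix. -/
def samplePath (k : ℕ) (ω : Ω) (x : P.Dec) (b : Fin A.B) :
    {y // y ∈ P.Y x.1} × Fin (R.N (k + 1) ω x) → ℝ :=
  fun u =>
    localMean P CL x.1 (R.loc (k + 1) ω x) (R.gridPoint (k + 1) ω x _ u) +
    (CFC.sqrt (Matrix.of fun u u' : {y // y ∈ P.Y x.1} × Fin (R.N (k + 1) ω x) =>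
        localCov CL (R.loc (k + 1) ω x) (R.gridPoint (k + 1) ω x _ u)
          (R.gridPoint (k + 1) ω x _ u')) *ᵥ
      fun u => R.mc k ω ⟨x, b, u.1, u.2.1⟩) u

/-- Estimated expected optimality gap of scenario `j` at `x` in iteration `k + 1`. -/
def gap (k : ℕ) (ω : Ω) (x : P.Dec) (j : Fin (R.N (k + 1) ω x)) : ℝ :=
  (A.B : ℝ)⁻¹ * ∑ b : Fin A.B,
    max 0 (P.q x.1 ((R.loc (k + 1) ω x).best j) (R.scenario (k + 1) ω x j)
      - ⨅ y : {y // y ∈ P.Y x.1}, R.samplePath CL k ω x b (y, j))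

/-- Gap-adjusted cost of scenario `j` at `x` in iteration `k + 1`; zero for `j` out of range. -/
def output (k : ℕ) (ω : Ω) (x : P.Dec) (j : ℕ) : ℝ :=
  if h : j < R.N (k + 1) ω x then
    P.c₀ x.1 + P.q x.1 ((R.loc (k + 1) ω x).best j) (R.scenario (k + 1) ω x j)
      - R.gap CL k ω x ⟨j, h⟩
  else 0

/-- Average of the gap-adjusted costs at `x` in iteration `k + 1`. -/
def outputMean (k : ℕ) (ω : Ω) (x : P.Dec) : ℝ :=
  (R.N (k + 1) ω x : ℝ)⁻¹ * ∑ j ∈ Finset.range (R.N (k + 1) ω x), R.output CL k ω x j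

/-- Mean of the `t`-th bootstrap resample (drawn with replacement) in iteration `k + 1`. -/
def bootMean (k : ℕ) (ω : Ω) (x : P.Dec) (t : Fin A.T) : ℝ :=
  (R.N (k + 1) ω x : ℝ)⁻¹ * ∑ j ∈ Finset.range (R.N (k + 1) ω x),
    R.output CL k ω x ⌊(R.N (k + 1) ω x : ℝ) * R.boot k ω (x, t, j)⌋₊

/-- Sample variance of the bootstrap means in iteration `k + 1`. -/
def bootVar (k : ℕ) (ω : Ω) (x : P.Dec) : ℝ :=
  ((A.T : ℝ) - 1)⁻¹ * ∑ t : Fin A.T,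
    (R.bootMean CL k ω x t - (A.T : ℝ)⁻¹ * ∑ t' : Fin A.T, R.bootMean CL k ω x t') ^ 2

open Classical in
/-- The objective estimate `Ḡ(x)` after `k` iterations, truncated to `[-Mbar, Mbar]`. -/
def Gbar : ℕ → Ω → P.Dec → ℝ
  | 0 => fun _ _ => 0
  | k + 1 => fun ω x =>
      if x ∈ R.D k ω then max (-A.Mbar) (min A.Mbar (R.outputMean CL k ω x)) else Gbar k ω x

open Classical in
/-- The estimated variance of `Ḡ(x)` after `k` iterations. -/
def V : ℕ → Ω → P.Dec → ℝ
  | 0 => fun _ _ => 0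
  | k + 1 => fun ω x => if x ∈ R.D k ω then R.bootVar CL k ω x else V k ω x

/-- Correlation function of the global metamodel on the feasible decisions. -/
def globalKer (φ : Vec p₁) (x x' : P.Dec) : ℝ := CG.ker φ x.1 x'.1

/-- Global posterior mean after `k` iterations. -/
def globalMean (k : ℕ) (ω : Ω) (x : P.Dec) : ℝ :=
  Kriging.postMean (R.θ k ω).1 (globalKer CG (R.θ k ω).2) (R.visited k ω) (R.V CL k ω)
    (R.Gbar CL k ω) x

open Classical in
/-- Global predictive variance after `k` iterations, bounded below by `σmin²` at visited points. -/
def globalVar (k : ℕ) (ω : Ω) (x : P.Dec) : ℝ :=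
  let s2 := Kriging.postCov (R.θ k ω).1 (globalKer CG (R.θ k ω).2) (R.visited k ω) (R.V CL k ω) x x
  if x ∈ R.visited k ω then max s2 (A.σmin ^ 2) else s2

/-- Posterior probability that `x` improves on the current best objective estimate. -/
def improveProb (k : ℕ) (ω : Ω) (x : P.Dec) : ℝ :=
  (gaussianReal (R.globalMean CG CL k ω x) (R.globalVar CG CL k ω x).toNNReal).real
    (Set.Iio (R.Gbar CL k ω (R.xstar k ω)))

/-- The sampling distribution `f^{(k+1)}`. -/
def f (k : ℕ) (ω : Ω) (x : P.Dec) : ℝ :=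
  R.improveProb CG CL k ω x / ∑ x' : P.Dec, R.improveProb CG CL k ω x'

/-- `R` is a run of the procedure (without budget limit) on `(Ω, μ)`. The σ-algebras carry the
information available: `ℋ k` after `k` iterations, `𝒢 k` after choosing the points to be visited in
iteration `k + 1`, `𝒦 k` after the second-stage search in iteration `k + 1`. -/
structure IsRun [mΩ : MeasurableSpace Ω] (μ : Measure Ω) (ℋ 𝒢 𝒦 : ℕ → MeasurableSpace Ω) :
    Prop where
  ℋ_le_𝒢 : ∀ k, ℋ k ≤ 𝒢 k
  𝒢_le_𝒦 : ∀ k, 𝒢 k ≤ 𝒦 k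
  𝒦_le_ℋ : ∀ k, 𝒦 k ≤ ℋ (k + 1)
  ℋ_le : ∀ k, ℋ k ≤ mΩ
  -- first-stage design points
  measurable_draw : ∀ k, Measurable[𝒢 k] (R.draw k)
  measurable_D : ∀ k (x : P.Dec), MeasurableSet[𝒢 k] {ω | x ∈ R.D k ω}
  D_zero : ∀ᵐ ω ∂μ, (R.D 0 ω).Nonempty
  mem_D : ∀ᵐ ω ∂μ, ∀ k, 1 ≤ k → ∀ x, x ∈ R.D k ω ↔ ∃ i, R.draw k ω i = x
  /-- given the past, the points are drawn independently from the sampling distribution -/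
  draw_law : ∀ k, 1 ≤ k → ∀ v : Fin A.s → P.Dec,
    μ[{ω | R.draw k ω = v}.indicator (fun _ => (1 : ℝ)) | ℋ k]
      =ᵐ[μ] fun ω => ∏ i, R.f CG CL k ω (v i)
  -- scenarios: i.i.d. from `F`, independent of the past
  measurable_scen : ∀ k, Measurable[𝒦 k] (R.scen k)
  scen_law : ∀ k, HasLaw (R.scen k) (Measure.infinitePi fun _ => P.F) μ
  scen_indep : ∀ k, Indep (MeasurableSpace.comap (R.scen k) inferInstance) (𝒢 k) μ
  -- second-stage search at the visited points
  lhd_nonempty : ∀ᵐ ω ∂μ, ∀ x, (R.lhd x ω).Nonempty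
  lhd_subset : ∀ᵐ ω ∂μ, ∀ x, ∀ z ∈ R.lhd x ω, z.1 ∈ P.Y x.1 ∧ z.2 ∈ P.Ξ
  secondStage : ∀ᵐ ω ∂μ, ∀ k, ∀ x ∈ R.D k ω,
    SecondStage P CL x.1 (A.threshold (R.visits (k + 1) ω x)) (R.scenario (k + 1) ω x)
      (R.N k ω x) (R.N (k + 1) ω x) (R.lhd x ω) (R.loc k ω x) (R.loc (k + 1) ω x)
  loc_unvisited : ∀ᵐ ω ∂μ, ∀ k x, x ∉ R.D k ω → R.loc (k + 1) ω x = R.loc k ω x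
  measurable_best : ∀ k x j, Measurable[𝒦 k] fun ω => (R.loc (k + 1) ω x).best j
  measurable_localMean : ∀ k (x : P.Dec), ∀ y ∈ P.Y x.1, ∀ j, Measurable[𝒦 k] fun ω =>
    localMean P CL x.1 (R.loc (k + 1) ω x) (y, R.scenario (k + 1) ω x j)
  measurable_localCov : ∀ k (x : P.Dec), ∀ y ∈ P.Y x.1, ∀ y' ∈ P.Y x.1, ∀ j j',
    Measurable[𝒦 k] fun ω => localCov CL (R.loc (k + 1) ω x)
      (y, R.scenario (k + 1) ω x j) (y', R.scenario (k + 1) ω x j')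
  -- simulation noise for sample paths and bootstrap, independent of the past
  measurable_mc : ∀ k, Measurable[ℋ (k + 1)] (R.mc k)
  measurable_boot : ∀ k, Measurable[ℋ (k + 1)] (R.boot k)
  noise_law : ∀ k, HasLaw (fun ω => (R.mc k ω, R.boot k ω))
    ((Measure.infinitePi fun _ => gaussianReal 0 1).prod
      (Measure.infinitePi fun _ => (volume : Measure ℝ).restrict (Set.Ico 0 1))) μ
  noise_indep : ∀ k, Indep
    (MeasurableSpace.comap (fun ω => (R.mc k ω, R.boot k ω)) inferInstance) (𝒦 k) μ
  -- global metamodel and current best decision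
  measurable_θ : ∀ k, Measurable[ℋ k] (R.θ k)
  isMLE : ∀ᵐ ω ∂μ, ∀ k, 1 ≤ k → Kriging.IsMLE CG.Θ (globalKer CG) (R.visited k ω) (R.V CL k ω)
    (R.Gbar CL k ω) (R.θ k ω)
  measurable_xstar : ∀ k, Measurable[ℋ k] (R.xstar k)
  xstar_mem : ∀ᵐ ω ∂μ, ∀ k, 1 ≤ k → R.xstar k ω ∈ R.visited k ω
  xstar_min : ∀ᵐ ω ∂μ, ∀ k, 1 ≤ k → ∀ x ∈ R.visited k ω,
    R.Gbar CL k ω (R.xstar k ω) ≤ R.Gbar CL k ω x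

end Run

/-- `f` belongs to the reproducing kernel Hilbert space on `Z` with kernel `K`, and its norm there is
at most `M`. -/
def RKHSNormLE {Z : Type} (K : Z → Z → ℝ) (f : Z → ℝ) (M : ℝ) : Prop :=
  ∃ (H : Type) (_ : NormedAddCommGroup H) (_ : InnerProductSpace ℝ H) (_ : CompleteSpace H)
    (_ : RKHS ℝ H Z ℝ), (∀ z w, RKHS.kernel H z w 1 = K z w) ∧ ∃ h : H, (∀ z, h z = f z) ∧ ‖h‖ ≤ M

end

/-! The key is that every decision keeps a sampling probability that is eventually bounded below by
a positive number depending on the run. A conditional Borel–Cantelli argument then makes it drawn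
infinitely often, and since the number of scenarios grows geometrically with the number of visits,
`N` tends to infinity.

For the lower bound, fix a run along which the global parameters converge. The limiting covariance
matrix on the finite set of decisions is positive definite, so by compactness its quadratic form
dominates `l |a|²` for some `l > 0`. By entrywise convergence the same holds eventually along the
run, with `l / 2` (`CorrelationFamily.exists_eventually_coercive`). From the second stage the
argument takes only `|Ḡ| ≤ Mbar` and `V ≥ 0`. The noise variances have no upper bound, so every
kriging estimate has to be uniform in `V`: - the posterior mean is bounded
(`Kriging.exists_abs_postMean_le`); the delicate part is the generalized least squares trend, whose
normalizing factor `1ᵀ(Σ + V)⁻¹1` may tend to zero (`Matrix.sq_inv_mulVec_one_le`); - the posterior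
variance is at least the coercivity constant off the design set (`Kriging.le_postCov_self`), and at
least `σmin²` on it by construction.

A normal law with bounded mean and variance bounded away from zero gives uniformly positive mass to
the half-line below the incumbent (`exists_le_gaussianReal_Iio`). No upper bound on the variance is
needed: a larger variance only moves the standardized threshold closer to zero from below. -/

noncomputable section

/-! ### Coercive quadratic forms -/

namespace Matrix

variable {n : Type*} [Fintype n]

/-- The quadratic form of `K` is at least `l` times the squared Euclidean norm. -/
def Coercive (K : Matrix n n ℝ) (l : ℝ) : Prop := ∀ a : n → ℝ, l * (a ⬝ᵥ a) ≤ a ⬝ᵥ (K *ᵥ a)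

lemma dotProduct_self_nonneg_real (a : n → ℝ) : 0 ≤ a ⬝ᵥ a :=
  Finset.sum_nonneg fun i _ => mul_self_nonneg (a i)

lemma sq_apply_le_dotProduct_self (a : n → ℝ) (i : n) : a i ^ 2 ≤ a ⬝ᵥ a := by
  rw [pow_two]
  exact Finset.single_le_sum (f := fun i => a i * a i) (fun i _ => mul_self_nonneg (a i))
    (Finset.mem_univ i)

lemma sq_dotProduct_le (a b : n → ℝ) : (a ⬝ᵥ b) ^ 2 ≤ (a ⬝ᵥ a) * (b ⬝ᵥ b) := by
  have := Finset.sum_mul_sq_le_sq_mul_sq Finset.univ a b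
  simpa only [dotProduct, pow_two] using this

lemma IsSymm.dotProduct_mulVec_comm {M : Matrix n n ℝ} (hM : M.IsSymm) (a b : n → ℝ) :
    a ⬝ᵥ (M *ᵥ b) = b ⬝ᵥ (M *ᵥ a) := by
  rw [dotProduct_mulVec, ← mulVec_transpose, hM.eq, dotProduct_comm]

/-- The constant is the minimum of the quadratic form on the compact Euclidean unit sphere;
homogeneity of degree two extends the bound to all vectors. -/
lemma PosDef.exists_coercive {K : Matrix n n ℝ} (hK : K.PosDef) : ∃ l > 0, K.Coercive l := by
  rcases isEmpty_or_nonempty n with hn | hn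
  · exact ⟨1, one_pos, fun a => by simp [dotProduct]⟩
  have hcomp : IsCompact {a : n → ℝ | a ⬝ᵥ a = 1} := by
    refine Metric.isCompact_of_isClosed_isBounded
      (isClosed_eq (by unfold dotProduct; fun_prop) continuous_const) ?_
    refine (Metric.isBounded_closedBall (x := (0 : n → ℝ)) (r := 1)).subset fun a ha => ?_
    rw [mem_closedBall_zero_iff, pi_norm_le_iff_of_nonneg zero_le_one]
    intro i
    rw [Real.norm_eq_abs, ← sq_le_one_iff_abs_le_one]
    exact (sq_apply_le_dotProduct_self a i).trans_eq ha
  have hne : {a : n → ℝ | a ⬝ᵥ a = 1}.Nonempty := by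
    classical
    exact ⟨Pi.single hn.some 1, by simp⟩
  have hcont : Continuous fun a : n → ℝ => a ⬝ᵥ (K *ᵥ a) := by
    unfold dotProduct mulVec dotProduct; fun_prop
  obtain ⟨u, hu, hmin⟩ := hcomp.exists_isMinOn hne hcont.continuousOn
  have hu0 : u ≠ 0 := by rintro rfl; simp at hu
  refine ⟨u ⬝ᵥ (K *ᵥ u), by simpa using hK.dotProduct_mulVec_pos hu0, fun a => ?_⟩
  rcases (dotProduct_self_nonneg_real a).eq_or_lt with h | h
  · rw [eq_comm, dotProduct_self_eq_zero] at h
    simp [h]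
  have hs : Real.sqrt (a ⬝ᵥ a) ^ 2 = a ⬝ᵥ a := Real.sq_sqrt h.le
  have hs0 : Real.sqrt (a ⬝ᵥ a) ≠ 0 := (Real.sqrt_pos.2 h).ne'
  have := hmin (a := (Real.sqrt (a ⬝ᵥ a))⁻¹ • a) (by
    simp only [Set.mem_ofPred_eq, smul_dotProduct, dotProduct_smul, smul_eq_mul]
    field_simp
    exact hs.symm)
  simp only [mulVec_smul, smul_dotProduct, dotProduct_smul, smul_eq_mul, Set.mem_ofPred_eq] at this
  calc _ ≤ _ := mul_le_mul_of_nonneg_right this h.le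
    _ = a ⬝ᵥ (K *ᵥ a) := by rw [← hs]; field_simp; simp [hs]

/-- Coercivity is stable under small entrywise perturbations. -/
lemma Coercive.of_abs_sub_le {K K' : Matrix n n ℝ} {l e : ℝ} (hK : K.Coercive l)
    (he : ∀ i j, |K' i j - K i j| ≤ e) : K'.Coercive (l - Fintype.card n * e) := by
  intro a
  -- Entrywise `|aᵢ aⱼ| ≤ (aᵢ² + aⱼ²) / 2`; summing over both indices produces the factor `card n`.
  have h : |a ⬝ᵥ ((K' - K) *ᵥ a)| ≤ Fintype.card n * e * (a ⬝ᵥ a) := by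
    have hterm : ∀ i j, |a i * ((K' - K) i j * a j)| ≤ e * ((a i ^ 2 + a j ^ 2) / 2) := by
      intro i j
      have he0 : 0 ≤ e := (abs_nonneg _).trans (he i j)
      have h1 : |a i| * |a j| ≤ (a i ^ 2 + a j ^ 2) / 2 := by
        nlinarith [sq_nonneg (|a i| - |a j|), sq_abs (a i), sq_abs (a j)]
      calc |a i * ((K' - K) i j * a j)| = |K' i j - K i j| * (|a i| * |a j|) := by
            rw [abs_mul, abs_mul, sub_apply]; ring
        _ ≤ e * ((a i ^ 2 + a j ^ 2) / 2) :=
            mul_le_mul (he i j) h1 (by positivity) he0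
    calc |a ⬝ᵥ ((K' - K) *ᵥ a)| = |∑ i, ∑ j, a i * ((K' - K) i j * a j)| := by
          simp only [dotProduct, mulVec, Finset.mul_sum]
      _ ≤ ∑ i, ∑ j, |a i * ((K' - K) i j * a j)| :=
          (Finset.abs_sum_le_sum_abs _ _).trans
            (Finset.sum_le_sum fun i _ => Finset.abs_sum_le_sum_abs _ _)
      _ ≤ ∑ i, ∑ j, e * ((a i ^ 2 + a j ^ 2) / 2) :=
          Finset.sum_le_sum fun i _ => Finset.sum_le_sum fun j _ => hterm i j
      _ = Fintype.card n * e * (a ⬝ᵥ a) := by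
          simp only [← Finset.mul_sum, ← Finset.sum_div, Finset.sum_add_distrib, Finset.sum_const,
            Finset.card_univ, nsmul_eq_mul, dotProduct, ← pow_two]
          ring
  rw [sub_mulVec, dotProduct_sub] at h
  have := hK a
  have := (abs_le.1 h).1
  linarith

lemma Coercive.posDef {M : Matrix n n ℝ} {l : ℝ} (hM : M.Coercive l) (hl : 0 < l)
    (hs : M.IsSymm) : M.PosDef := by
  refine .of_dotProduct_mulVec_pos (by
    rw [IsHermitian, conjTranspose_eq_transpose_of_trivial]; exact hs) fun a ha => ?_
  have h0 : 0 < a ⬝ᵥ a := (dotProduct_self_nonneg_real a).lt_of_ne' (by simpa using ha)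
  simpa using (mul_pos hl h0).trans_le (hM a)

section Inverse

variable [DecidableEq n] {M : Matrix n n ℝ} {l : ℝ}

lemma Coercive.mulVec_inv_mulVec (hM : M.Coercive l) (hl : 0 < l) (hs : M.IsSymm) (h : n → ℝ) :
    M *ᵥ (M⁻¹ *ᵥ h) = h := by
  rw [mulVec_mulVec, mul_nonsing_inv _ ((isUnit_iff_isUnit_det _).1 (hM.posDef hl hs).isUnit),
    one_mulVec]

/-- For `u = M⁻¹h`, coercivity and Cauchy–Schwarz give `l |u|² ≤ u · h ≤ |u| |h|`. Only the
coercivity constant enters, so adding noise to the diagonal does not spoil the bound. -/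
lemma Coercive.sq_inv_mulVec_le (hM : M.Coercive l) (hl : 0 < l) (hs : M.IsSymm) (h : n → ℝ) :
    (M⁻¹ *ᵥ h) ⬝ᵥ (M⁻¹ *ᵥ h) ≤ (h ⬝ᵥ h) / l ^ 2 := by
  set u := M⁻¹ *ᵥ h with hu
  have h1 : l * (u ⬝ᵥ u) ≤ u ⬝ᵥ h := by
    have := hM u
    rwa [hM.mulVec_inv_mulVec hl hs h] at this
  have h2 := sq_dotProduct_le u h
  rw [le_div_iff₀ (by positivity)]
  rcases (dotProduct_self_nonneg_real u).eq_or_lt with h0 | h0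
  · rw [← h0, zero_mul]; exact dotProduct_self_nonneg_real h
  · have h3 : (l * (u ⬝ᵥ u)) ^ 2 ≤ (u ⬝ᵥ h) ^ 2 := pow_le_pow_left₀ (by positivity) h1 2
    refine le_of_mul_le_mul_left ?_ h0
    nlinarith

end Inverse

/-- Weights of the generalized least squares mean are bounded uniformly in the noise variances. -/
lemma sq_inv_mulVec_one_le [DecidableEq n] [Nonempty n] {K : Matrix n n ℝ} {l v : ℝ} {W : n → ℝ}
    (hl : 0 < l) (hK : K.Coercive l) (hs : K.IsSymm) (hd : ∀ i, K i i = v) (hW : ∀ i, 0 ≤ W i) :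
    let p := (K + diagonal W)⁻¹ *ᵥ (fun _ => 1)
    0 < (fun _ => 1) ⬝ᵥ p ∧ p ⬝ᵥ p ≤ v / l * ((fun _ => 1) ⬝ᵥ p) ^ 2 := by
  intro p
  have hMs : (K + diagonal W).IsSymm := hs.add (isSymm_diagonal W)
  have hquad : ∀ w : ℝ, (∀ i, w ≤ W i) → (K + diagonal W).Coercive (l + w) := by
    intro w hw a
    rw [add_mulVec, dotProduct_add, add_mul]
    refine add_le_add (hK a) ?_
    simp only [dotProduct, mulVec_diagonal, Finset.mul_sum]
    refine Finset.sum_le_sum fun i _ => ?_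
    nlinarith [hw i, mul_self_nonneg (a i)]
  have hM : (K + diagonal W).Coercive l := by simpa using hquad 0 hW
  have hMp : (K + diagonal W) *ᵥ p = fun _ => 1 := hM.mulVec_inv_mulVec hl hMs _
  set o := (fun _ => (1 : ℝ)) ⬝ᵥ p with ho
  have hpp : p ⬝ᵥ ((K + diagonal W) *ᵥ p) = o := by rw [hMp, dotProduct_comm]
  have hp0 : p ≠ 0 := by
    intro h
    rw [h, mulVec_zero] at hMp
    exact zero_ne_one (congrFun hMp (Classical.arbitrary n))
  have hpos : 0 < p ⬝ᵥ p := (dotProduct_self_nonneg_real p).lt_of_ne' (by simpa using hp0)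
  have ho0 : 0 < o := by
    have := hM p
    rw [hpp] at this
    exact (mul_pos hl hpos).trans_le this
  refine ⟨ho0, ?_⟩
  -- The smallest noise variance `W i` controls both sides: it improves the coercivity constant to
  -- `l + W i`, and it bounds `1 / o` from above by `v + W i`.
  obtain ⟨i, hi⟩ := Finite.exists_min W
  have h1 : (l + W i) * (p ⬝ᵥ p) ≤ o := by
    have := hquad (W i) hi p
    rwa [hpp] at this
  have hMii : (K + diagonal W) i i = v + W i := by simp [hd]
  have hlv : l ≤ v := by simpa [hd] using hK (Pi.single i 1)
  have h2 : 1 ≤ o * (v + W i) := by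
    -- The form is nonnegative at `o eᵢ - p`. Expanding gives `o² (v + W i) - 2o + o ≥ 0`, which is
    -- `h2` after division by `o`. In statistical terms, the best linear unbiased estimate of the
    -- trend has variance `1 / o`, at most that of the single observation `i`.
    have hq := (mul_nonneg hl.le (dotProduct_self_nonneg_real _)).trans
      (hM (o • Pi.single i 1 - p))
    have e1 : (Pi.single i 1 : n → ℝ) ⬝ᵥ ((K + diagonal W) *ᵥ Pi.single i 1) = v + W i := by
      simp [hd]
    have e2 : (Pi.single i 1 : n → ℝ) ⬝ᵥ ((K + diagonal W) *ᵥ p) = 1 := by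
      rw [hMp]; simp
    have e3 : p ⬝ᵥ ((K + diagonal W) *ᵥ (Pi.single i 1 : n → ℝ)) = 1 := by
      rw [hMs.dotProduct_mulVec_comm, e2]
    simp only [mulVec_sub, mulVec_smul, sub_dotProduct, dotProduct_sub, smul_dotProduct,
      dotProduct_smul, smul_eq_mul, e1, e2, e3, hpp] at hq
    refine le_of_mul_le_mul_left ?_ ho0
    nlinarith
  have hlw : 0 < l + W i := add_pos_of_pos_of_nonneg hl (hW i)
  have h3 : (l + W i) * (p ⬝ᵥ p) ≤ o ^ 2 * (v + W i) := by nlinarith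
  -- Since `l ≤ v`, the ratio `(v + W i) / (l + W i)` is largest at `W i = 0`; this removes the
  -- noise from the bound.
  have h4 : l * (v + W i) ≤ v * (l + W i) := by nlinarith [hW i]
  rw [div_mul_eq_mul_div, le_div_iff₀ hl]
  refine le_of_mul_le_mul_left ?_ hlw
  calc (l + W i) * (p ⬝ᵥ p * l) = l * ((l + W i) * (p ⬝ᵥ p)) := by ring
    _ ≤ l * (o ^ 2 * (v + W i)) := by gcongr
    _ = o ^ 2 * (l * (v + W i)) := by ring
    _ ≤ o ^ 2 * (v * (l + W i)) := by gcongr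
    _ = (l + W i) * (v * o ^ 2) := by ring

end Matrix

/-! ### Uniform bounds for kriging predictors -/

namespace Kriging

variable {E : Type*} {v l : ℝ} {r : E → E → ℝ} {S : Finset E} {V G : E → ℝ}

/-- The spatial covariance matrix on the whole domain. -/
def spatialCov (v : ℝ) (r : E → E → ℝ) : Matrix E E ℝ := v • Matrix.of r

lemma spatialCov_apply (z z' : E) : spatialCov v r z z' = v * r z z' := rfl

open Classical in
lemma covMatrix_eq : covMatrix v r S V =
    (spatialCov v r).submatrix (fun i : S => i.1) (fun i : S => i.1) +
      diagonal fun i : S => V i.1 := rfl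

open Classical in
lemma covMatrix_isSymm (hr : (spatialCov v r).IsSymm) : (covMatrix v r S V).IsSymm :=
  (hr.submatrix _).add (isSymm_diagonal _)

open Classical in
/-- Extension by zero of a vector indexed by `S`. -/
def extendZero (w : S → ℝ) (z : E) : ℝ := if h : z ∈ S then w ⟨z, h⟩ else 0

variable [Fintype E]

lemma extendZero_dotProduct (w : S → ℝ) (b : E → ℝ) :
    extendZero w ⬝ᵥ b = w ⬝ᵥ fun i => b i.1 := by
  calc ∑ z, extendZero w z * b z = ∑ z ∈ S, extendZero w z * b z :=
        (Finset.sum_subset (Finset.subset_univ S)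
          fun z _ hz => by simp [extendZero, hz]).symm
    _ = ∑ i : S, extendZero w i.1 * b i.1 := (Finset.sum_coe_sort S _).symm
    _ = ∑ i : S, w i * b i.1 := by simp [extendZero]

lemma mulVec_extendZero (K : Matrix E E ℝ) (w : S → ℝ) (z : E) :
    (K *ᵥ extendZero w) z = (fun i : S => K z i.1) ⬝ᵥ w := by
  rw [mulVec, dotProduct_comm, extendZero_dotProduct, dotProduct_comm]

lemma extendZero_dotProduct_mulVec (K : Matrix E E ℝ) (w : S → ℝ) :
    extendZero w ⬝ᵥ (K *ᵥ extendZero w) =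
      w ⬝ᵥ (K.submatrix (fun i : S => i.1) (fun i : S => i.1) *ᵥ w) := by
  rw [extendZero_dotProduct]
  congr 1
  funext i
  rw [mulVec_extendZero]
  rfl

/-- Padding with zeros preserves both the norm and the quadratic form, so one constant on the whole
domain serves every design set. -/
lemma coercive_submatrix {K : Matrix E E ℝ} (hK : K.Coercive l) :
    (K.submatrix (fun i : S => i.1) (fun i : S => i.1)).Coercive l := by
  intro a
  have h := hK (extendZero a)
  rw [extendZero_dotProduct_mulVec, extendZero_dotProduct] at h
  simpa [extendZero] using h

omit [Fintype E] in
lemma dotProduct_diagonal_mulVec_nonneg (hV : ∀ z ∈ S, 0 ≤ V z) [DecidableEq S] (a : S → ℝ) :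
    0 ≤ a ⬝ᵥ ((Matrix.diagonal fun i : S => V i.1) *ᵥ a) := by
  refine Finset.sum_nonneg fun i _ => ?_
  rw [mulVec_diagonal]
  nlinarith [mul_nonneg (hV i.1 i.2) (mul_self_nonneg (a i))]

lemma coercive_covMatrix (hK : (spatialCov v r).Coercive l) (hV : ∀ z ∈ S, 0 ≤ V z) :
    (covMatrix v r S V).Coercive l := by
  classical
  intro a
  rw [covMatrix_eq, add_mulVec, dotProduct_add]
  exact (coercive_submatrix hK a).trans
    (le_add_of_nonneg_right (dotProduct_diagonal_mulVec_nonneg hV a))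

lemma dotProduct_self_le_card_mul {c : ℝ} {a : S → ℝ} (ha : ∀ i, |a i| ≤ c) :
    a ⬝ᵥ a ≤ Fintype.card E * c ^ 2 := by
  calc ∑ i, a i * a i ≤ ∑ _i : S, c ^ 2 := Finset.sum_le_sum fun i _ => by
        rw [← pow_two, ← sq_abs]
        exact pow_le_pow_left₀ (abs_nonneg _) (ha i) 2
    _ = S.card * c ^ 2 := by simp
    _ ≤ _ := by
        gcongr
        exact S.card_le_univ

omit [Fintype E] in
lemma precision_isSymm (hr : (spatialCov v r).IsSymm) : (precision v r S V).IsSymm := by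
  classical
  rw [IsSymm, precision, transpose_nonsing_inv, (covMatrix_isSymm hr).eq]

lemma ones_nonneg (hl : 0 < l) (hr : (spatialCov v r).IsSymm) (hK : (spatialCov v r).Coercive l)
    (hV : ∀ z ∈ S, 0 ≤ V z) : 0 ≤ ones v r S V := by
  classical
  have hM := coercive_covMatrix hK hV
  have h := (mul_nonneg hl.le (dotProduct_self_nonneg_real _)).trans
    (hM (precision v r S V *ᵥ fun _ => 1))
  rwa [precision, hM.mulVec_inv_mulVec hl (covMatrix_isSymm hr), dotProduct_comm] at h

/-- With `p = (Σ + V)⁻¹1` the trend is `(p · G) / (1 · p)`. Cauchy–Schwarz and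
`sq_inv_mulVec_one_le` bound the quotient even when its denominator is small. -/
lemma sq_trend_le {b : ℝ} (hl : 0 < l) (hr : (spatialCov v r).IsSymm)
    (hK : (spatialCov v r).Coercive l) (hd : ∀ z, r z z = 1) (hV : ∀ z ∈ S, 0 ≤ V z)
    (hS : S.Nonempty) (hG : ∀ z ∈ S, |G z| ≤ b) :
    trend v r S V G ^ 2 ≤ v / l * (Fintype.card E * b ^ 2) := by
  classical
  have : Nonempty S := hS.to_subtype
  obtain ⟨ho, hp⟩ := sq_inv_mulVec_one_le (W := fun i : S => V i.1) (v := v) hl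
    (coercive_submatrix hK) (hr.submatrix _)
    (fun i => by simp [spatialCov_apply, hd]) (fun i => hV i.1 i.2)
  rw [← covMatrix_eq] at ho hp
  change 0 < ones v r S V at ho
  change _ ≤ v / l * ones v r S V ^ 2 at hp
  have hG' := dotProduct_self_le_card_mul (a := fun i : S => G i.1) (c := b) fun i => hG i.1 i.2
  rw [trend, (precision_isSymm hr).dotProduct_mulVec_comm, mul_pow, inv_pow,
    inv_mul_le_iff₀ (by positivity)]
  refine (sq_dotProduct_le _ _).trans ?_
  calc _ ≤ (Fintype.card E * b ^ 2) * (v / l * ones v r S V ^ 2) :=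
        mul_le_mul hG' hp (dotProduct_self_nonneg_real _) (by positivity)
    _ = _ := by ring

/-- The posterior mean is bounded, uniformly in the noise variances. -/
lemma exists_abs_postMean_le (E : Type*) [Fintype E] {l : ℝ} (hl : 0 < l) (B b : ℝ) : ∃ C : ℝ,
    ∀ (v : ℝ) (r : E → E → ℝ) (S : Finset E) (V G : E → ℝ) (z : E), (spatialCov v r).IsSymm →
      (spatialCov v r).Coercive l → (∀ z, r z z = 1) → (∀ z z', |v * r z z'| ≤ B) →
      (∀ z ∈ S, 0 ≤ V z) → S.Nonempty → (∀ z ∈ S, |G z| ≤ b) → |postMean v r S V G z| ≤ C := by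
  classical
  set n : ℝ := (Fintype.card E : ℝ) with hn
  set t := Real.sqrt (B / l * (n * b ^ 2)) with ht
  -- Here `t` bounds the trend; under the root, `n B²` bounds the squared norm of `Σ(z, ·)` and the
  -- other factor that of the precision matrix applied to the centred outputs, whose entries are at
  -- most `b + t`.
  refine ⟨t + Real.sqrt ((n * B ^ 2) * (n * (b + t) ^ 2 / l ^ 2)), ?_⟩
  intro v r S V G z hr hK hd hB hV hS hG
  have hn0 : 0 ≤ n := by positivity
  have htrend : |trend v r S V G| ≤ t := by
    refine Real.abs_le_sqrt ((sq_trend_le hl hr hK hd hV hS hG).trans ?_)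
    have : v ≤ B := by simpa [hd] using (le_abs_self _).trans (hB z z)
    gcongr
  refine (abs_add_le _ _).trans (add_le_add htrend (Real.abs_le_sqrt ?_))
  refine (sq_dotProduct_le _ _).trans ?_
  refine mul_le_mul (dotProduct_self_le_card_mul fun i => hB z i.1) ?_
    (dotProduct_self_nonneg_real _) (by positivity)
  refine ((coercive_covMatrix hK hV).sq_inv_mulVec_le hl (covMatrix_isSymm hr) _).trans ?_
  gcongr
  exact dotProduct_self_le_card_mul fun i =>
    (abs_sub _ _).trans (add_le_add (hG i.1 i.2) htrend)

/-- The posterior variance is bounded below outside the design set. -/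
lemma le_postCov_self (hl : 0 < l) (hr : (spatialCov v r).IsSymm)
    (hK : (spatialCov v r).Coercive l) (hV : ∀ z ∈ S, 0 ≤ V z) {z : E} (hz : z ∉ S) :
    l ≤ postCov v r S V z z := by
  classical
  have hM := coercive_covMatrix hK hV
  set w := precision v r S V *ᵥ covVec v r S z with hw
  have hMw : covMatrix v r S V *ᵥ w = covVec v r S z :=
    hM.mulVec_inv_mulVec hl (covMatrix_isSymm hr) _
  -- `w` holds the simple kriging weights. Dropping the noise from `wᵀ(Σ + V)w = Σ(z, ·) · w` leaves
  -- the purely spatial form.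
  have hwMw : extendZero w ⬝ᵥ (spatialCov v r *ᵥ extendZero w) ≤ covVec v r S z ⬝ᵥ w := by
    rw [extendZero_dotProduct_mulVec, dotProduct_comm _ w, ← hMw, covMatrix_eq, add_mulVec,
      dotProduct_add]
    exact le_add_of_nonneg_right (dotProduct_diagonal_mulVec_nonneg hV w)
  have hcross : (Pi.single z 1 : E → ℝ) ⬝ᵥ (spatialCov v r *ᵥ extendZero w) =
      covVec v r S z ⬝ᵥ w := by
    rw [single_dotProduct, one_mul, mulVec_extendZero]
    rfl
  -- `a` is the coefficient vector of the prediction error. Its entry at `z` is `1` because `z ∉ S`,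
  -- so its spatial variance is at least `l`; that variance is at most the posterior variance
  -- without the nonnegative trend term.
  set a : E → ℝ := Pi.single z 1 - extendZero w with ha
  have h1 : 1 ≤ a ⬝ᵥ a := by
    simpa [ha, extendZero, hz] using sq_apply_le_dotProduct_self a z
  have h2 := hK a
  have h3 : a ⬝ᵥ (spatialCov v r *ᵥ a) = v * r z z - 2 * (covVec v r S z ⬝ᵥ w) +
      extendZero w ⬝ᵥ (spatialCov v r *ᵥ extendZero w) := by
    simp only [ha, mulVec_sub, sub_dotProduct, dotProduct_sub, hcross,
      hr.dotProduct_mulVec_comm (extendZero w) (Pi.single z 1)]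
    rw [single_dotProduct, mulVec_single_one, one_mul]
    simp only [col_apply, spatialCov_apply]
    ring
  have h4 : 0 ≤ eta v r S V z * (ones v r S V)⁻¹ * eta v r S V z := by
    have := inv_nonneg.2 (ones_nonneg hl hr hK hV)
    nlinarith [mul_nonneg this (mul_self_nonneg (eta v r S V z))]
  have h5 : l ≤ l * (a ⬝ᵥ a) := le_mul_of_one_le_right hl.le h1
  rw [postCov, ← hw]
  linarith

end Kriging

/-! ### Lower bound for normal probabilities -/

/-- A normal law with bounded mean and non-degenerate variance charges half-lines uniformly. -/
lemma exists_le_gaussianReal_Iio {s : ℝ} (hs : 0 < s) (K : ℝ) : ∃ ε > 0, ∀ m w c : ℝ,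
    s ≤ w → m - c ≤ K → ε ≤ (gaussianReal m w.toNNReal).real (Set.Iio c) := by
  -- The standardized threshold satisfies `(c - m) / √w ≥ -|K| / √w ≥ -|K| / √s`; the absolute value
  -- also covers negative `K`. The witness is positive because Lebesgue measure is absolutely
  -- continuous with respect to the standard normal law.
  refine ⟨(gaussianReal 0 1).real (Set.Iio (-(|K| / √s))), ?_, fun m w c hw hK => ?_⟩
  · rw [measureReal_def, gt_iff_lt, ENNReal.toReal_pos_iff]
    refine ⟨pos_iff_ne_zero.2 fun h => ?_, measure_lt_top _ _⟩
    have := gaussianReal_absolutelyContinuous' 0 one_ne_zero h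
    simp at this
  · have hw0 : 0 < w := hs.trans_le hw
    have hmap : gaussianReal m w.toNNReal = (gaussianReal 0 1).map fun x => √w * x + m := by
      have hcomp : (fun x => √w * x + m) = (fun x => x + m) ∘ fun x => √w * x := rfl
      rw [hcomp, ← Measure.map_map (by fun_prop) (by fun_prop), gaussianReal_map_const_mul, gaussianReal_map_add_const]
      congr 1
      · simp
      · ext
        simp [Real.sq_sqrt hw0.le, hw0.le]
    rw [hmap, map_measureReal_apply (by fun_prop) measurableSet_Iio]
    refine measureReal_mono fun x hx => ?_
    simp only [Set.mem_Iio, Set.mem_preimage] at hx ⊢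
    have h1 : |K| / √w ≤ |K| / √s := by gcongr
    have h2 : x < -(|K| / √w) := by linarith
    have h3 : √w * x < √w * -(|K| / √w) := by gcongr
    have h4 : √w * -(|K| / √w) = -|K| := by
      have : √w ≠ 0 := (Real.sqrt_pos.2 hw0).ne'
      field_simp
    linarith [le_abs_self K]

/-! ### Covariance matrices along convergent parameters -/

namespace CorrelationFamily

variable {d₁ d₂ m p : ℕ} {P : TwoStageProblem d₁ d₂ m} (C : CorrelationFamily (Vec d₁) p)

lemma posDef_spatialCov {θ : ℝ × Vec p} (hθ : θ ∈ C.Θ) :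
    (Kriging.spatialCov θ.1 (Run.globalKer (P := P) C θ.2)).PosDef :=
  (C.posDef θ hθ P.X).smul (C.var_pos θ hθ)

/-- Along parameters converging to an admissible pair, the covariance matrices are eventually
uniformly coercive and uniformly bounded. -/
lemma exists_eventually_coercive {θ₀ : ℝ × Vec p} (hθ₀ : θ₀ ∈ C.Θ) {θ : ℕ → ℝ × Vec p}
    (hmem : ∀ᶠ k in atTop, θ k ∈ C.Θ) (hθ : Tendsto θ atTop (𝓝 θ₀)) :
    ∃ l > 0, ∃ B : ℝ, ∀ᶠ k in atTop,
      (Kriging.spatialCov (θ k).1 (Run.globalKer (P := P) C (θ k).2)).Coercive l ∧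
      ∀ z z' : P.Dec, |(θ k).1 * Run.globalKer C (θ k).2 z z'| ≤ B := by
  obtain ⟨l, hl, hc⟩ := (C.posDef_spatialCov (P := P) hθ₀).exists_coercive
  set K := fun θ : ℝ × Vec p => Kriging.spatialCov θ.1 (Run.globalKer (P := P) C θ.2)
  -- Continuity in the parameter is given only within the admissible set, hence convergence within
  -- its projection.
  have hφ : Tendsto (fun k => (θ k).2) atTop (𝓝[Prod.snd '' C.Θ] θ₀.2) :=
    tendsto_nhdsWithin_iff.2 ⟨(continuous_snd.tendsto _).comp hθ,
      hmem.mono fun k hk => Set.mem_image_of_mem _ hk⟩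
  have hK : ∀ z z', Tendsto (fun k => K (θ k) z z') atTop (𝓝 (K θ₀ z z')) := fun z z' =>
    ((continuous_fst.tendsto _).comp hθ).mul
      ((C.continuousOn (z.1 - z'.1) θ₀.2 (Set.mem_image_of_mem _ hθ₀)).tendsto.comp hφ)
  -- Chosen so that the perturbation loss `card * e` is at most `l / 2`; the `+ 1` keeps the
  -- denominator positive without nonemptiness.
  set e : ℝ := l / (2 * (Fintype.card P.Dec + 1)) with he
  have he0 : 0 < e := by positivity
  have hev : ∀ᶠ k in atTop, ∀ z z', |K (θ k) z z' - K θ₀ z z'| ≤ e := by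
    rw [eventually_all]; intro z
    rw [eventually_all]; intro z'
    filter_upwards [Metric.tendsto_nhds.1 (hK z z') e he0] with k hk
    exact (Real.dist_eq _ _ ▸ hk).le
  refine ⟨l / 2, by positivity, (∑ z, ∑ z', |K θ₀ z z'|) + e, hev.mono fun k hk => ⟨?_, ?_⟩⟩
  · intro a
    refine le_trans ?_ (hc.of_abs_sub_le hk a)
    have : Fintype.card P.Dec * e ≤ l / 2 := by
      rw [he, ← mul_div_assoc, div_le_div_iff₀ (by positivity) two_pos]
      nlinarith
    exact mul_le_mul_of_nonneg_right (by linarith) (dotProduct_self_nonneg_real a)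
  · intro z z'
    have h1 : |K θ₀ z z'| ≤ ∑ z, ∑ z', |K θ₀ z z'| :=
      (Finset.single_le_sum (f := fun z' => |K θ₀ z z'|) (fun _ _ => abs_nonneg _)
        (Finset.mem_univ z')).trans
        (Finset.single_le_sum (f := fun z => ∑ z', |K θ₀ z z'|)
          (fun _ _ => Finset.sum_nonneg fun _ _ => abs_nonneg _) (Finset.mem_univ z))
    have h2 := abs_sub_abs_le_abs_sub (K (θ k) z z') (K θ₀ z z')
    have h3 := hk z z'
    change |K (θ k) z z'| ≤ _
    linarith

end CorrelationFamily

lemma AlgParams.tendsto_numScen (A : AlgParams) : Tendsto A.numScen atTop atTop := by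
  rw [← tendsto_add_atTop_iff_nat 1]
  have h : Tendsto (fun t : ℕ => (A.n₀ : ℝ) * A.g ^ t) atTop atTop :=
    (tendsto_pow_atTop_atTop_of_one_lt A.one_lt_g).const_mul_atTop
      (Nat.cast_pos.2 A.n₀_pos)
  simpa [AlgParams.numScen, Function.comp_def] using tendsto_nat_ceil_atTop.comp h

/-! ### Lower bound for the sampling probabilities -/

namespace Run

variable {d₁ d₂ m p₁ p₂ : ℕ} {P : TwoStageProblem d₁ d₂ m} {A : AlgParams} {Ω : Type*}
  (R : Run P A p₁ p₂ Ω) (CG : CorrelationFamily (Vec d₁) p₁)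
  (CL : CorrelationFamily (Vec d₂ × Vec m) p₂)

lemma bootVar_nonneg (k : ℕ) (ω : Ω) (x : P.Dec) : 0 ≤ R.bootVar CL k ω x := by
  have : (2 : ℝ) ≤ A.T := by exact_mod_cast A.two_le_T
  exact mul_nonneg (inv_nonneg.2 (by linarith)) (Finset.sum_nonneg fun _ _ => sq_nonneg _)

lemma V_nonneg (k : ℕ) (ω : Ω) (x : P.Dec) : 0 ≤ R.V CL k ω x := by
  induction k with
  | zero => exact le_rfl
  | succ k ih =>
    simp only [V]
    split_ifs
    exacts [R.bootVar_nonneg CL k ω x, ih]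

lemma abs_Gbar_le (k : ℕ) (ω : Ω) (x : P.Dec) : |R.Gbar CL k ω x| ≤ A.Mbar := by
  induction k with
  | zero => simpa [Gbar] using A.Mbar_pos.le
  | succ k ih =>
    simp only [Gbar]
    split_ifs
    · exact abs_le.2 ⟨le_max_left _ _,
        max_le (by linarith [A.Mbar_pos]) (min_le_left _ _)⟩
    · exact ih

lemma improveProb_le_one (k : ℕ) (ω : Ω) (x : P.Dec) : R.improveProb CG CL k ω x ≤ 1 :=
  measureReal_le_one

/-- Each of the finitely many improvement probabilities is at most `1`, so normalization divides by
at most the number of decisions; `ε > 0` makes the normalizing sum positive. -/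
lemma le_f {k : ℕ} {ω : Ω} {x : P.Dec} {ε : ℝ} (hε : 0 < ε)
    (h : ε ≤ R.improveProb CG CL k ω x) : ε / Fintype.card P.Dec ≤ R.f CG CL k ω x := by
  have hsum : R.improveProb CG CL k ω x ≤ ∑ x', R.improveProb CG CL k ω x' :=
    Finset.single_le_sum (f := fun x' => R.improveProb CG CL k ω x')
      (fun _ _ => measureReal_nonneg) (Finset.mem_univ x)
  have hcard : ∑ x', R.improveProb CG CL k ω x' ≤ Fintype.card P.Dec :=
    (Finset.sum_le_sum fun x' _ => R.improveProb_le_one CG CL k ω x').trans_eq (by simp)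
  exact div_le_div₀ (hε.le.trans h) h (hε.trans_le (h.trans hsum)) hcard

/-- The sampling probabilities are eventually bounded away from zero. -/
lemma exists_eventually_le_f {θ₀ : ℝ × Vec p₁} (hθ₀ : θ₀ ∈ CG.Θ) {ω : Ω}
    (hmem : ∀ᶠ k in atTop, R.θ k ω ∈ CG.Θ) (hθ : Tendsto (fun k => R.θ k ω) atTop (𝓝 θ₀))
    (hvis : ∀ᶠ k in atTop, (R.visited k ω).Nonempty) (x : P.Dec) :
    ∃ ε > 0, ∀ᶠ k in atTop, ε ≤ R.f CG CL k ω x := by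
  obtain ⟨l, hl, B, hev⟩ := CG.exists_eventually_coercive (P := P) hθ₀ hmem hθ
  obtain ⟨M, hM⟩ := Kriging.exists_abs_postMean_le P.Dec hl B A.Mbar
  -- The variance is at least `l` at unvisited points and `σmin²` at visited ones; the mean is at
  -- most `M` and the incumbent value at least `-Mbar`.
  obtain ⟨ε, hε, hgauss⟩ := exists_le_gaussianReal_Iio
    (lt_min hl (pow_pos A.σmin_pos 2)) (M + A.Mbar)
  have : Nonempty P.Dec := ⟨x⟩
  refine ⟨ε / Fintype.card P.Dec, by positivity, ?_⟩
  filter_upwards [hev, hmem, hvis] with k ⟨hco, hB⟩ hk hv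
  have hsymm : (Kriging.spatialCov (R.θ k ω).1
      (globalKer (P := P) CG (R.θ k ω).2)).IsSymm := by
    have := (CG.posDef_spatialCov (P := P) hk).isHermitian
    rwa [IsHermitian, conjTranspose_eq_transpose_of_trivial] at this
  have hone : ∀ z : P.Dec, globalKer CG (R.θ k ω).2 z z = 1 := fun z => by
    simpa [globalKer, CorrelationFamily.ker] using CG.corr_zero _ hk
  have hmean := hM _ _ (R.visited k ω) (R.V CL k ω) (R.Gbar CL k ω) x hsymm hco hone hB
    (fun z _ => R.V_nonneg CL k ω z) hv (fun z _ => R.abs_Gbar_le CL k ω z)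
  refine R.le_f CG CL hε (hgauss _ _ _ ?_ ?_)
  · rw [globalVar]
    by_cases hx : x ∈ R.visited k ω
    · simp only [hx, if_true]
      exact (min_le_right _ _).trans (le_max_right _ _)
    · simp only [hx, if_false]
      exact (min_le_left _ _).trans
        (Kriging.le_postCov_self hl hsymm hco (fun z _ => R.V_nonneg CL k ω z) hx)
  · have h1 := (abs_le.1 hmean).2
    have h2 := (abs_le.1 (R.abs_Gbar_le CL k ω (R.xstar k ω))).1
    rw [globalMean]
    linarith

lemma tendsto_visits {ω : Ω} {x : P.Dec} (h : ∃ᶠ k in atTop, x ∈ R.D k ω) :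
    Tendsto (fun k => R.visits k ω x) atTop atTop := by
  classical
  have hv : (fun k => R.visits k ω x) = Nat.count fun k => x ∈ R.D k ω := by
    funext k
    rw [Nat.count_eq_card_filter_range, visits]
  rw [hv]
  exact tendsto_atTop_atTop_of_monotone (Nat.count_monotone _) fun b =>
    ⟨Nat.nth _ b, (Nat.count_nth_of_infinite (Nat.frequently_atTop_iff_infinite.1 h) b).ge⟩

/-! ### Infinitely many visits by conditional Borel–Cantelli -/

variable {R CG CL}

/-- Conditional Borel–Cantelli: a point whose sampling probability stays away from zero is drawn
infinitely often. -/
lemma IsRun.ae_frequently_mem_D [mΩ : MeasurableSpace Ω] {μ : Measure Ω} [IsProbabilityMeasure μ]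
    {ℋ 𝒢 𝒦 : ℕ → MeasurableSpace Ω} (hR : R.IsRun CG CL μ ℋ 𝒢 𝒦) {x : P.Dec}
    (hf : ∀ᵐ ω ∂μ, ∃ ε > 0, ∀ᶠ k in atTop, ε ≤ R.f CG CL k ω x) :
    ∀ᵐ ω ∂μ, ∃ᶠ k in atTop, x ∈ R.D k ω := by
  have hmono : ∀ k, ℋ k ≤ ℋ (k + 1) := fun k =>
    ((hR.ℋ_le_𝒢 k).trans (hR.𝒢_le_𝒦 k)).trans (hR.𝒦_le_ℋ k)
  let ℱ : Filtration ℕ mΩ := ⟨ℋ, monotone_nat_of_le_succ hmono, hR.ℋ_le⟩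
  -- The event that all `A.s` draws equal `x` suffices, and its conditional probability is exactly
  -- `f(x) ^ A.s`. The index is shifted because `draw k` is known at time `k + 1` and its law is
  -- conditional on time `k`; nothing is drawn at time `0`.
  let s : ℕ → Set Ω := fun n => Nat.casesOn n ∅ fun k => {ω | R.draw k ω = fun _ => x}
  have hs : ∀ n, MeasurableSet[ℱ n] (s n) := by
    rintro (_ | k)
    · exact @MeasurableSet.empty _ (ℱ 0)
    · exact ((hR.𝒢_le_𝒦 k).trans (hR.𝒦_le_ℋ k)) _
        (hR.measurable_draw k (MeasurableSet.singleton fun _ => x))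
  have hlaw : ∀ᵐ ω ∂μ, ∀ k, 1 ≤ k →
      (μ[(s (k + 1)).indicator (1 : Ω → ℝ) | ℱ k]) ω = R.f CG CL k ω x ^ A.s := by
    rw [ae_all_iff]; intro k
    rw [ae_all_iff]; intro hk
    filter_upwards [hR.draw_law k hk fun _ => x] with ω hω
    exact hω.trans (by simp)
  filter_upwards [ae_mem_limsup_atTop_iff (ℱ := ℱ) μ hs, hlaw, hf, hR.mem_D]
    with ω hiff hω ⟨ε, hε, hev⟩ hD
  have hdiv : Tendsto (fun n => ∑ k ∈ Finset.range n,
      (μ[(s (k + 1)).indicator (1 : Ω → ℝ) | ℱ k]) ω) atTop atTop := by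
    obtain ⟨k₀, hk₀⟩ := eventually_atTop.1 (hev.and (eventually_ge_atTop 1))
    rw [← tendsto_add_atTop_iff_nat k₀]
    -- Beyond `k₀` every term is at least `ε ^ A.s`, so the partial sums exceed a fixed initial sum
    -- plus a linearly growing term.
    refine tendsto_atTop_mono (f := fun n : ℕ => (∑ k ∈ Finset.range k₀,
      (μ[(s (k + 1)).indicator (1 : Ω → ℝ) | ℱ k]) ω) + n * ε ^ A.s) (fun n => ?_)
      (tendsto_atTop_add_const_left _ _
        (tendsto_natCast_atTop_atTop.atTop_mul_const (by positivity)))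
    rw [add_comm n, Finset.sum_range_add]
    refine add_le_add le_rfl ?_
    calc (n : ℝ) * ε ^ A.s = ∑ _k ∈ Finset.range n, ε ^ A.s := by simp
      _ ≤ _ := Finset.sum_le_sum fun k _ => by
        obtain ⟨h1, h2⟩ := hk₀ (k₀ + k) (Nat.le_add_right _ _)
        rw [hω _ h2]
        exact pow_le_pow_left₀ hε.le h1 _
  have hfreq := mem_limsup_iff_frequently_mem.1 (hiff.2 hdiv)
  rw [← map_add_atTop_eq_nat 1, frequently_map] at hfreq
  -- Index `0` is discarded: the initial design need not come from the draws.
  refine (hfreq.and_eventually (eventually_ge_atTop 1)).mono fun k ⟨hk, hk1⟩ => ?_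
  exact (hD k hk1 x).2 ⟨⟨0, A.s_pos⟩, congrFun hk _⟩

end Run

end

theorem lemma1 {d₁ d₂ m p₁ p₂ : ℕ} (P : TwoStageProblem d₁ d₂ m) (A : AlgParams)
    (CG : CorrelationFamily (Vec d₁) p₁) (CL : CorrelationFamily (Vec d₂ × Vec m) p₂)
    -- the true parameters of the global and of the local Gaussian processes
    (τ2 : ℝ) (φG : Vec p₁) (hG : (τ2, φG) ∈ CG.Θ)
    (σ2 : P.Dec → ℝ) (φL : P.Dec → Vec p₂) (hL : ∀ x, (σ2 x, φL x) ∈ CL.Θ)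
    -- bounded response, bounded norm in the reproducing kernel Hilbert space
    (hbdd : ∃ M : ℝ, ∀ x ∈ P.X, ∀ y ∈ P.Y x, ∀ ξ ∈ P.Ξ, |P.c₀ x + P.q x y ξ| ≤ M)
    (hrkhs : ∃ M : ℝ, ∀ x : P.Dec,
      RKHSNormLE (Z := {z : Vec d₂ × Vec m // z.1 ∈ P.Y x.1 ∧ z.2 ∈ P.Ξ})
        (fun z w => CL.ker (φL x) z.1 w.1) (fun z => P.q x.1 z.1.1 z.1.2) M)
    -- positive spatial variances
    (hτ : 0 < τ2) (hσ : ∀ x, 0 < σ2 x)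
    -- a run of the procedure
    {Ω : Type*} [MeasurableSpace Ω] (μ : Measure Ω) [IsProbabilityMeasure μ]
    (R : Run P A p₁ p₂ Ω) (ℋ 𝒢 𝒦 : ℕ → MeasurableSpace Ω) (hR : R.IsRun CG CL μ ℋ 𝒢 𝒦)
    -- consistency of the maximum likelihood estimates (at a first-stage decision:
    -- as the amount of data collected there grows)
    (hMLEG : ∀ᵐ ω ∂μ, Tendsto (fun k => R.θ k ω) atTop (𝓝 (τ2, φG)))
    (hMLEL : ∀ x : P.Dec, ∀ᵐ ω ∂μ, Tendsto (fun k => R.N k ω x) atTop atTop →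
      Tendsto (fun k => (R.loc k ω x).param) atTop (𝓝 (σ2 x, φL x))) :
    ∀ x : P.Dec, ∀ᵐ ω ∂μ, Tendsto (fun k => R.N k ω x) atTop atTop := by

  intro x
  have hf : ∀ᵐ ω ∂μ, ∃ ε > 0, ∀ᶠ k in atTop, ε ≤ R.f CG CL k ω x := by
    filter_upwards [hMLEG, hR.isMLE, hR.xstar_mem] with ω hθ hmle hstar
    exact R.exists_eventually_le_f CG CL hG ((eventually_ge_atTop 1).mono fun k hk => (hmle k hk).1)
      hθ ((eventually_ge_atTop 1).mono fun k hk => ⟨_, hstar k hk⟩) x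
  filter_upwards [hR.ae_frequently_mem_D hf] with ω hω
  exact A.tendsto_numScen.comp (R.tendsto_visits hω)
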